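/- For positive integers $n$ and $d$, let $M(n,d)$ denote the maximum size of a permutation array on $n$ symbols with Hamming distance at least $d$, that is, the maximum size of a non-empty set $P$ of permutations of $\{0,1,\ldots,n-1\}$ such that any two distinct $\sigma,\tau\in P$ satisfy $|\{x : \sigma(x)\neq\tau(x)\}|\geq d$. Let $q$ be a prime power such that $q>5$, $q\equiv 2 \pmod 3$, and $q\not\equiv 0,1 \pmod 5$. Then $$M(q-1,q-5)\geq q(q-1)(q+1)\quad\text{and}\quad M(q-2,q-5)\geq q(q+1).$$ -/

import Mathlib

/-- A permutation array on `n` symbols: a non-empty set of permutations of `{0, …, n-1}`. It has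
Hamming distance at least `d` when any two distinct members `σ`, `τ` differ in at least `d`
symbols; `hammingDist σ τ` is the number of `x` with `σ x ≠ τ x`. -/
def IsPermArray (n d : ℕ) (P : Finset (Equiv.Perm (Fin n))) : Prop :=
  P.Nonempty ∧ ∀ σ ∈ P, ∀ τ ∈ P, σ ≠ τ → d ≤ hammingDist (⇑σ) (⇑τ)

/-- `maxPermArray n d` is `M(n, d)`: the maximum size of a permutation array on `n` symbols with
Hamming distance at least `d`. -/
noncomputable def maxPermArray (n d : ℕ) : ℕ :=
  sSup {k : ℕ | ∃ P : Finset (Equiv.Perm (Fin n)), IsPermArray n d P ∧ P.card = k}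

/-- The supremum defining `M(n, d)` is an attained maximum. -/
theorem maxPermArray_isGreatest (n d : ℕ) :
    IsGreatest {k : ℕ | ∃ P : Finset (Equiv.Perm (Fin n)), IsPermArray n d P ∧ P.card = k}
      (maxPermArray n d) := by
  have hb : BddAbove
      {k : ℕ | ∃ P : Finset (Equiv.Perm (Fin n)), IsPermArray n d P ∧ P.card = k} := by
    refine ⟨Fintype.card (Equiv.Perm (Fin n)), ?_⟩
    rintro k ⟨P, -, rfl⟩
    exact Finset.card_le_univ P
  refine ⟨Nat.sSup_mem ⟨1, {1}, ⟨Finset.singleton_nonempty _, ?_⟩, Finset.card_singleton _⟩ hb,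
    fun k hk => le_csSup hb hk⟩
  intro σ hσ τ hτ h
  rw [Finset.mem_singleton] at hσ hτ
  exact absurd (hσ.trans hτ.symm) h

/-!
For `q ≡ 2 (mod 3)` and `q ≢ 0, 1 (mod 5)`, contract the group `PGL(2, q)`, acting on the `q + 1`
points of the projective line over `𝔽_q`, at two points. The result is a family of
`q * (q - 1) * (q + 1)` permutations of the remaining `q - 1` points, and the claim is that two of
them agree in at most four of these, so that they differ in at least `q - 5`.

Contracting `σ` and `τ` at `n` changes the quotient `π = τ⁻¹ * σ` into a permutation that moves
at most three fewer points (`card_support_le_contractQuot_add_three`). As `PGL(2, q)` is sharply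
3-transitive, `π ≠ 1` has at most two fixed points. If it has none, then the bound
`q + 1 - 3 - 3 = q - 5` is immediate. If it has a fixed point, then it is conjugate to an affine map
`z ↦ a * z + b`, and the congruences imply that it has no cycle of length 3 or 5
(`noCycle_of_mem_moebiusGroup`). For such a `π`, the two contractions together cost at most four
moved points (`card_support_le_contractQuot_contractQuot`): a contraction costs three only when it
collapses a 3-cycle, and one that costs two shortens a cycle by two, so that a 3-cycle appearing
after it stems from a 3-cycle or a 5-cycle. Hence at least `q - 1 - 4 = q - 5` points remain moved.

The second bound follows from the first by pigeonhole (`le_maxPermArray_of_mul_le`): among the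
`q * (q - 1) * (q + 1)` permutations of `q - 1` symbols, at least `q * (q + 1)` share their value at
a given symbol, which can then be deleted.
-/

/-! ### Contraction of permutations -/

section Contraction

open Equiv Equiv.Perm

variable {α : Type*} [DecidableEq α]

/-- The contraction of `σ` at `n`: the point `n` is cut out of its cycle (in one-line notation, the
symbol `n` is replaced by `σ n`), and becomes a fixed point instead of being deleted. -/
def contract (n : α) (σ : Perm α) : Perm α := σ * swap n (σ⁻¹ n)

theorem contract_apply_self (n : α) (σ : Perm α) : contract n σ n = n := by
  simp [contract]

theorem contract_apply_of_fixed {n m : α} {σ : Perm α} (h : σ m = m) : contract n σ m = m := by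
  have h' : σ⁻¹ m = m := by rw [Perm.inv_eq_iff_eq, h]
  rcases eq_or_ne n m with rfl | hnm
  · exact contract_apply_self _ _
  · have h1 : m ≠ σ⁻¹ n := fun e => hnm (by rw [← h, e]; simp)
    rw [contract, Perm.mul_apply, swap_apply_of_ne_of_ne hnm.symm h1, h]

/-- The effect of contracting `σ` and `τ` at `n` on the quotient `π = τ⁻¹ * σ`, where
`a = σ⁻¹ n` and `π a = τ⁻¹ n`. -/
def contractQuot (n a : α) (π : Perm α) : Perm α := swap n (π a) * π * swap n a

theorem contract_inv_mul_contract (n : α) (σ τ : Perm α) :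
    (contract n τ)⁻¹ * contract n σ = contractQuot n (σ⁻¹ n) (τ⁻¹ * σ) := by
  simp [contract, contractQuot, mul_assoc]

variable (n a : α) (π : Perm α)

theorem contractQuot_apply (x : α) :
    contractQuot n a π x = swap n (π a) (π (swap n a x)) := rfl

theorem contractQuot_apply_self : contractQuot n a π n = n := by
  simp [contractQuot_apply]

variable [Fintype α]

theorem support_sdiff_contractQuot :
    π.support \ (contractQuot n a π).support ⊆ {n, a, π a} := by
  intro x
  simp only [Finset.mem_sdiff, mem_support, not_not, Finset.mem_insert, Finset.mem_singleton,
    contractQuot_apply, swap_apply_def]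
  rintro ⟨h1, h2⟩
  have := π.injective.eq_iff (a := x) (b := a)
  grind

theorem card_support_le_contractQuot_add_three :
    π.support.card ≤ (contractQuot n a π).support.card + 3 := by
  have h1 := Finset.le_card_sdiff (contractQuot n a π).support π.support
  have h2 := Finset.card_le_card (support_sdiff_contractQuot n a π)
  have h3 := Finset.card_le_three (a := n) (b := a) (c := π a)
  omega

/-- For a prime `k`: the permutation `π` has no cycle of length `k`. -/
def NoCycle (k : ℕ) (π : Perm α) : Prop := ∀ x, (π ^ k) x = x → π x = x

variable {n a π}

/-- A contraction creates three fixed points `n`, `a`, `π a` only by collapsing a 3-cycle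
`n → a → π a → n`. -/
theorem card_support_le_contractQuot_add_two (h : NoCycle 3 π) :
    π.support.card ≤ (contractQuot n a π).support.card + 2 := by
  by_contra hc
  have h1 := Finset.le_card_sdiff (contractQuot n a π).support π.support
  have h4 := support_sdiff_contractQuot n a π
  have h3 := Finset.card_le_three (a := n) (b := a) (c := π a)
  have h5 := Finset.eq_of_subset_of_card_le h4 (by omega)
  have hn := h n
  have e1 : n ∈ π.support \ (contractQuot n a π).support := by rw [h5]; simp
  have e2 : a ∈ π.support \ (contractQuot n a π).support := by rw [h5]; simp
  have e3 : π a ∈ π.support \ (contractQuot n a π).support := by rw [h5]; simp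
  simp only [Finset.mem_sdiff, mem_support, not_not, contractQuot_apply, swap_apply_def,
    pow_succ, pow_zero, one_mul, Perm.mul_apply] at *
  grind

/-- If a contraction creates two fixed points, then one of `n → a → π a` and
`a → π a → n` is part of a cycle of `π`; the contraction removes two points from that cycle. -/
theorem apply_eq_of_two_le_card_support_sdiff
    (h : 2 ≤ (π.support \ (contractQuot n a π).support).card) :
    a ≠ π a ∧ (π n = a ∨ π (π a) = n) := by
  have hs := support_sdiff_contractQuot n a π
  obtain ⟨x, hx, y, hy, hxy⟩ := Finset.one_lt_card.1 h
  have hx' := hs hx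
  have hy' := hs hy
  simp only [Finset.mem_sdiff, mem_support, not_not, contractQuot_apply, swap_apply_def,
    Finset.mem_insert, Finset.mem_singleton] at *
  have i1 := π.injective.eq_iff (a := x) (b := a)
  have i2 := π.injective.eq_iff (a := y) (b := a)
  grind

/-- If the contraction creates two fixed points, it shortens one cycle by two and keeps the others,
so a 3-cycle in the result stems from a 3-cycle or a 5-cycle. -/
theorem card_support_le_contractQuot_add_one (h3 : NoCycle 3 π) (h5 : NoCycle 5 π)
    (h : ¬ NoCycle 3 (contractQuot n a π)) :
    π.support.card ≤ (contractQuot n a π).support.card + 1 := by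
  by_contra hc
  have h1 := Finset.le_card_sdiff (contractQuot n a π).support π.support
  obtain ⟨hab, hor⟩ := apply_eq_of_two_le_card_support_sdiff (n := n) (a := a) (π := π)
    (by omega)
  apply h
  intro x hx
  by_contra hne
  set π' := contractQuot n a π with hπ'
  have key : ∀ z, π' z = swap n (π a) (π (swap n a z)) := fun z => rfl
  have hfn : π' n = n := contractQuot_apply_self n a π
  obtain ⟨y, hy⟩ : ∃ y, π' x = y := ⟨_, rfl⟩
  obtain ⟨z, hz⟩ : ∃ z, π' y = z := ⟨_, rfl⟩
  have hzx : π' z = x := by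
    rw [← hz, ← hy]; exact hx
  have hxy : x ≠ y := by rw [← hy]; exact fun e => hne e.symm
  have hyz : y ≠ z := by grind
  have hzx' : z ≠ x := by grind
  have hxn : x ≠ n := by grind
  have hyn : y ≠ n := by grind
  have hzn : z ≠ n := by grind
  -- Following `x`, `y`, `z` around `π` returns to `x` after three steps, or after five if the
  -- two removed points lie in between; both are excluded.
  have a3 := h3 x
  have a5 := h5 x
  have ix := π.injective.eq_iff (a := x) (b := a)
  have iy := π.injective.eq_iff (a := y) (b := a)
  have iz := π.injective.eq_iff (a := z) (b := a)
  have jx := π.injective.eq_iff (a := x) (b := n)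
  have jy := π.injective.eq_iff (a := y) (b := n)
  have jz := π.injective.eq_iff (a := z) (b := n)
  have kx := π.injective.eq_iff (a := x) (b := π a)
  have ky := π.injective.eq_iff (a := y) (b := π a)
  have kz := π.injective.eq_iff (a := z) (b := π a)
  have kxy := π.injective.eq_iff (a := x) (b := y)
  have kyz := π.injective.eq_iff (a := y) (b := z)
  have kxz := π.injective.eq_iff (a := x) (b := z)
  rw [key] at hy hz hzx
  simp only [swap_apply_def, pow_succ, pow_zero, one_mul, Perm.mul_apply] at *
  rcases hor with e | e
  · grind
  · grind

/-- Without cycles of length 3 and 5, two successive contractions create at most four fixed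
points. A contraction creates three only by collapsing a 3-cycle. If that happens in the second
one, then the 3-cycle was either present or arose from a 5-cycle, unless the first contraction
created at most one fixed point. -/
theorem card_support_le_contractQuot_contractQuot (m b : α) (h3 : NoCycle 3 π)
    (h5 : NoCycle 5 π) :
    π.support.card ≤ (contractQuot m b (contractQuot n a π)).support.card + 4 := by
  by_cases h : NoCycle 3 (contractQuot n a π)
  · have := card_support_le_contractQuot_add_two (n := n) (a := a) h3
    have := card_support_le_contractQuot_add_two (n := m) (a := b) h
    omega
  · have := card_support_le_contractQuot_add_one h3 h5 h
    have := card_support_le_contractQuot_add_three m b (contractQuot n a π)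
    omega

end Contraction

/-! ### Lower bounds for `M(n, d)` -/

section LowerBounds

open Equiv

/-- The Hamming distance of two permutations is the number of points moved by their quotient. -/
theorem hammingDist_perm_eq_card_support {α : Type*} [Fintype α] [DecidableEq α]
    (σ τ : Perm α) : hammingDist (⇑σ) (⇑τ) = (τ⁻¹ * σ).support.card := by
  unfold hammingDist
  congr 1
  ext x
  simp [Equiv.symm_apply_eq]

theorem card_le_maxPermArray {ι : Type*} [Fintype ι] {n d : ℕ} (hd : 0 < d)
    (f : ι → Perm (Fin n)) (hf : ∀ i j, i ≠ j → d ≤ hammingDist (⇑(f i)) (⇑(f j))) :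
    Fintype.card ι ≤ maxPermArray n d := by
  classical
  rcases isEmpty_or_nonempty ι with h | h
  · simp
  have hinj : Function.Injective f := by
    intro i j hij
    by_contra hne
    have := hf i j hne
    rw [hij, hammingDist_self] at this
    omega
  refine (maxPermArray_isGreatest n d).2 ⟨Finset.univ.image f, ⟨by simp, ?_⟩, ?_⟩
  · intro σ hσ τ hτ hne
    obtain ⟨i, -, rfl⟩ := Finset.mem_image.1 hσ
    obtain ⟨j, -, rfl⟩ := Finset.mem_image.1 hτ
    exact hf i j fun e => hne (by rw [e])
  · rw [Finset.card_image_of_injective _ hinj, Finset.card_univ]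

/-- Points fixed by all members of a family of permutations can be deleted without changing the
Hamming distances. -/
theorem card_le_maxPermArray_of_fixed {ι α : Type*} [Fintype ι] [Fintype α] [DecidableEq α]
    (s : Finset α) {d : ℕ} (hd : 0 < d) (f : ι → Perm α) (hs : ∀ i, ∀ x ∈ s, f i x = x)
    (hf : ∀ i j, i ≠ j → d ≤ hammingDist (⇑(f i)) (⇑(f j))) :
    Fintype.card ι ≤ maxPermArray (Fintype.card α - s.card) d := by
  have hc : Fintype.card {x // x ∉ s} = Fintype.card α - s.card := by
    simp [Fintype.card_subtype_compl]
  let e : {x // x ∉ s} ≃ Fin (Fintype.card α - s.card) := Fintype.equivFinOfCardEq hc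
  have hs' : ∀ i x, f i x ∉ s ↔ x ∉ s := fun i x => by
    refine not_congr ⟨fun h => ?_, fun h => by rwa [hs i x h]⟩
    rwa [← (f i).injective (hs i _ h)]
  refine card_le_maxPermArray hd (fun i => e.permCongr ((f i).subtypePerm (hs' i))) ?_
  intro i j hij
  refine (hf i j hij).trans ?_
  unfold hammingDist
  refine Finset.card_le_card_of_surjOn (fun y => ((e.symm y : {x // x ∉ s}) : α)) ?_
  intro x hx
  have hx' : f i x ≠ f j x := by simpa using hx
  have hxs : x ∉ s := fun h => hx' (by rw [hs i x h, hs j x h])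
  refine ⟨e ⟨x, hxs⟩, ?_, by simp⟩
  simpa [Equiv.permCongr_apply, Subtype.ext_iff] using hx'

/-- Members of a permutation array that agree at a symbol form, after deletion of that symbol, an
array on `n` symbols. -/
theorem le_maxPermArray_of_mul_le {n d k : ℕ} (hd : 0 < d)
    (h : (n + 1) * k ≤ maxPermArray (n + 1) d) : k ≤ maxPermArray n d := by
  classical
  obtain ⟨P, ⟨-, hP⟩, hcard⟩ := (maxPermArray_isGreatest (n + 1) d).1
  obtain ⟨y, -, hy⟩ := Finset.exists_le_card_fiber_of_mul_le_card_of_maps_to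
    (s := P) (t := Finset.univ) (f := fun σ => σ 0) (n := k) (fun _ _ => Finset.mem_univ _)
    Finset.univ_nonempty (by rw [hcard]; simpa using h)
  refine hy.trans ?_
  have := card_le_maxPermArray_of_fixed (ι := {σ // σ ∈ P.filter fun σ => σ 0 = y})
    {(0 : Fin (n + 1))} hd (fun σ => swap 0 y * σ.1) ?_ ?_
  · rw [Fintype.card_coe] at this
    simpa using this
  · intro σ x hx
    have h2 := (Finset.mem_filter.1 σ.2).2
    rw [Finset.mem_singleton.1 hx]
    simp [h2]
  · intro σ τ hne
    have := hP σ.1 (Finset.mem_filter.1 σ.2).1 τ.1 (Finset.mem_filter.1 τ.2).1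
      fun e => hne (Subtype.ext e)
    refine this.trans_eq ?_
    rw [hammingDist_perm_eq_card_support, hammingDist_perm_eq_card_support]
    simp [mul_assoc]

end LowerBounds

/-! ### Möbius transformations of a finite projective line -/

section Moebius

open Equiv OnePoint

/-- For `k` coprime to both `|F|` and `|F| - 1`, the polynomial `1 + X + ⋯ + X ^ (k - 1)` has no
root in the finite field `F`. -/
theorem geom_sum_ne_zero_of_coprime {F : Type*} [Field F] [Fintype F] {k : ℕ}
    (h0 : k.Coprime (Fintype.card F)) (h1 : k.Coprime (Fintype.card F - 1)) (a : F) :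
    ∑ i ∈ Finset.range k, a ^ i ≠ 0 := by
  intro h
  have ha : a ^ k = 1 := by
    have := geom_sum_mul a k
    rw [h, zero_mul] at this
    exact (sub_eq_zero.1 this.symm)
  have ha0 : a ≠ 0 := by
    rintro rfl
    rcases Nat.eq_zero_or_pos k with rfl | hk
    · have h2 : Fintype.card F = 1 := by simpa using h0
      exact absurd h2 Fintype.one_lt_card.ne'
    · rw [zero_pow hk.ne'] at ha
      exact zero_ne_one ha
  have ha1 : a = 1 := by
    have d1 : orderOf a ∣ k := orderOf_dvd_of_pow_eq_one ha
    have d2 : orderOf a ∣ Fintype.card F - 1 :=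
      orderOf_dvd_of_pow_eq_one (FiniteField.pow_card_sub_one_eq_one a ha0)
    exact orderOf_eq_one_iff.1 (Nat.eq_one_of_dvd_coprimes h1 d1 d2)
  have d1 : addOrderOf (1 : F) ∣ k := addOrderOf_dvd_of_nsmul_eq_zero (by simpa [ha1] using h)
  have d2 : addOrderOf (1 : F) ∣ Fintype.card F := addOrderOf_dvd_card
  exact one_ne_zero (AddMonoid.addOrderOf_eq_one_iff.1 (Nat.eq_one_of_dvd_coprimes h0 d1 d2))

theorem NoCycle.of_conj {X : Type*} {k : ℕ} {π : Perm X} (h : Perm X)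
    (hk : NoCycle k (h⁻¹ * π * h)) : NoCycle k π := by
  intro x hx
  have := hk (h⁻¹ x)
  rw [show h⁻¹ * π * h = h⁻¹ * π * h⁻¹⁻¹ by rw [inv_inv], conj_pow] at this
  simpa [hx] using this

theorem pow_apply_of_affine {F : Type*} [Field F] {π : Perm (OnePoint F)} {a b : F}
    (h : ∀ z : F, π z = ((a * z + b : F) : OnePoint F)) (k : ℕ) (z : F) :
    (π ^ k) z =
      ((z + (∑ i ∈ Finset.range k, a ^ i) * ((a - 1) * z + b) : F) : OnePoint F) := by
  induction k with
  | zero => simp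
  | succ k ih =>
    rw [pow_succ', Perm.mul_apply, ih, h, coe_eq_coe, Finset.sum_range_succ,
      ← sub_eq_zero]
    have := geom_sum_mul a k
    linear_combination ((a - 1) * z + b) * this

variable (F : Type*) [Field F] [DecidableEq F]

/-- The group `PGL(2, F)` as a permutation group on the projective line `F ∪ {∞}`. -/
def moebiusGroup : Subgroup (Perm (OnePoint F)) :=
  (MulAction.toPermHom (GL (Fin 2) F) (OnePoint F)).range

variable {F}

theorem exists_mem_moebiusGroup_infty (x : OnePoint F) : ∃ h ∈ moebiusGroup F, h ∞ = x := by
  induction x with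
  | infty => exact ⟨1, one_mem _, rfl⟩
  | coe c =>
    refine ⟨_, ⟨Matrix.GeneralLinearGroup.mkOfDetNeZero !![c, 1; 1, 0] (by simp), rfl⟩, ?_⟩
    simp [smul_infty_eq_ite, Matrix.GeneralLinearGroup.mkOfDetNeZero]

theorem exists_affine_of_mem_moebiusGroup {π : Perm (OnePoint F)} (h : π ∈ moebiusGroup F)
    (hinf : π ∞ = ∞) : ∃ a b : F, ∀ z : F, π z = ((a * z + b : F) : OnePoint F) := by
  obtain ⟨g, rfl⟩ := h
  have hc : g 1 0 = 0 := smul_infty_eq_self_iff.1 hinf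
  have hdet := g.det_ne_zero
  rw [Matrix.det_fin_two, hc, mul_zero, sub_zero] at hdet
  have hd : g 1 1 ≠ 0 := right_ne_zero_of_mul hdet
  refine ⟨g 0 0 / g 1 1, g 0 1 / g 1 1, fun z => ?_⟩
  have : g • (z : OnePoint F) = ((g 0 0 / g 1 1 * z + g 0 1 / g 1 1 : F) : OnePoint F) := by
    rw [smul_some_eq_ite, hc, zero_mul, zero_add, if_neg hd, coe_eq_coe]
    field_simp
  exact this

/-- A Möbius transformation with a fixed point has no short cycles: it is conjugate to an affine
map `z ↦ a * z + b`, for which `π ^ k z = z` amounts to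
`(1 + a + ⋯ + a ^ (k - 1)) * (π z - z) = 0`. -/
theorem noCycle_of_mem_moebiusGroup [Fintype F] {k : ℕ} (h0 : k.Coprime (Fintype.card F))
    (h1 : k.Coprime (Fintype.card F - 1)) {π : Perm (OnePoint F)} (hπ : π ∈ moebiusGroup F)
    {x : OnePoint F} (hx : π x = x) : NoCycle k π := by
  obtain ⟨h, hh, rfl⟩ := exists_mem_moebiusGroup_infty x
  apply NoCycle.of_conj h
  have hinf : (h⁻¹ * π * h) ∞ = ∞ := by simp [hx]
  obtain ⟨a, b, hab⟩ :=
    exists_affine_of_mem_moebiusGroup (mul_mem (mul_mem (inv_mem hh) hπ) hh) hinf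
  intro z hz
  induction z with
  | infty => exact hinf
  | coe z =>
    rw [pow_apply_of_affine hab, coe_eq_coe, add_eq_left, mul_eq_zero] at hz
    have := hz.resolve_left (geom_sum_ne_zero_of_coprime h0 h1 a)
    rw [hab, coe_eq_coe]
    linear_combination this

/-- A non-trivial Möbius transformation has at most two fixed points. -/
theorem card_le_card_support_add_two [Fintype F] [DecidableEq (OnePoint F)] {π : Perm (OnePoint F)}
    (hπ : π ∈ moebiusGroup F) (hne : π ≠ 1) :
    Fintype.card F + 1 ≤ π.support.card + 2 := by
  have hc : Fintype.card F + 1 = Fintype.card (OnePoint F) := Fintype.card_option.symm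
  rw [hc, ← Finset.card_univ]
  by_cases hx : ∃ x, π x = x
  · obtain ⟨x, hx⟩ := hx
    obtain ⟨h, hh, rfl⟩ := exists_mem_moebiusGroup_infty x
    have hinf : (h⁻¹ * π * h) ∞ = ∞ := by simp [hx]
    obtain ⟨a, b, hab⟩ :=
      exists_affine_of_mem_moebiusGroup (mul_mem (mul_mem (inv_mem hh) hπ) hh) hinf
    have hcs : (h⁻¹ * π * h).support.card = π.support.card := by
      simpa using Perm.card_support_conj (σ := h⁻¹) (τ := π)
    have hne' : h⁻¹ * π * h ≠ 1 := by
      intro e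
      rw [e] at hcs
      exact hne (Perm.support_eq_empty_iff.1 (Finset.card_eq_zero.1 (by simpa using hcs.symm)))
    rw [← hcs]
    have hsub : Finset.univ \ (h⁻¹ * π * h).support ⊆ {∞, ((b / (1 - a) : F) : OnePoint F)} := by
      intro z hz
      rw [Finset.mem_sdiff, Perm.notMem_support] at hz
      induction z with
      | infty => simp
      | coe z =>
        have hz' := hz.2
        rw [hab, coe_eq_coe] at hz'
        -- a translation with a finite fixed point is the identity
        have ha : 1 - a ≠ 0 := by
          intro ha
          apply hne'
          ext w : 1
          induction w with
          | infty => exact hinf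
          | coe w =>
            rw [hab, Perm.one_apply, coe_eq_coe]
            linear_combination hz' + (z - w) * ha
        have : z = b / (1 - a) := by
          field_simp
          linear_combination -hz'
        simp [this]
    have h1 := Finset.card_le_card hsub
    have h2 := Finset.le_card_sdiff (h⁻¹ * π * h).support Finset.univ
    have h3 := Finset.card_le_two (a := ∞) (b := ((b / (1 - a) : F) : OnePoint F))
    omega
  · have : π.support = Finset.univ := by
      ext x
      simpa using fun e => hx ⟨x, e⟩
    rw [this]
    omega

/-- A matrix acting trivially is scalar, as it fixes `∞`, `0` and `1`. -/
theorem card_ker_toPermHom_le [Fintype F] :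
    Nat.card (MulAction.toPermHom (GL (Fin 2) F) (OnePoint F)).ker ≤ Fintype.card F - 1 := by
  rw [← Fintype.card_units, ← Nat.card_eq_fintype_card]
  have key : ∀ g ∈ (MulAction.toPermHom (GL (Fin 2) F) (OnePoint F)).ker,
      g 1 0 = 0 ∧ g 0 1 = 0 ∧ g 0 0 = g 1 1 := by
    intro g hg
    have hg' : ∀ x : OnePoint F, g • x = x := fun x => congrArg (fun π : Perm _ => π x) hg
    have hc : g 1 0 = 0 := smul_infty_eq_self_iff.1 (hg' ∞)
    have hdet := g.det_ne_zero
    rw [Matrix.det_fin_two, hc, mul_zero, sub_zero] at hdet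
    have hd : g 1 1 ≠ 0 := right_ne_zero_of_mul hdet
    have e0 := hg' ((0 : F) : OnePoint F)
    have e1 := hg' ((1 : F) : OnePoint F)
    rw [smul_some_eq_ite, hc, zero_mul, zero_add, if_neg hd, coe_eq_coe, div_eq_iff hd] at e0 e1
    have hb : g 0 1 = 0 := by simpa using e0
    exact ⟨hc, hb, by simpa [hb] using e1⟩
  have hne : ∀ g : (MulAction.toPermHom (GL (Fin 2) F) (OnePoint F)).ker, g.1 0 0 ≠ 0 := by
    intro g e
    have hdet := g.1.det_ne_zero
    rw [Matrix.det_fin_two, e, (key _ g.2).1] at hdet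
    simp at hdet
  refine Nat.card_le_card_of_injective (fun g => Units.mk0 (g.1 0 0) (hne g)) ?_
  intro g g' h
  have h00 : g.1 0 0 = g'.1 0 0 := congrArg Units.val h
  obtain ⟨hc, hb, hd⟩ := key _ g.2
  obtain ⟨hc', hb', hd'⟩ := key _ g'.2
  ext i j
  fin_cases i <;> fin_cases j
  · exact h00
  · exact hb.trans hb'.symm
  · exact hc.trans hc'.symm
  · exact hd.symm.trans (h00.trans hd')

theorem le_card_moebiusGroup [Fintype F] :
    Fintype.card F * (Fintype.card F - 1) * (Fintype.card F + 1) ≤ Nat.card (moebiusGroup F) := by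
  have h1 := Subgroup.index_mul_card (MulAction.toPermHom (GL (Fin 2) F) (OnePoint F)).ker
  rw [Subgroup.index_ker, Matrix.card_GL_field] at h1
  have h2 := card_ker_toPermHom_le (F := F)
  have h3 : 1 < Fintype.card F := Fintype.one_lt_card
  change Nat.card (moebiusGroup F) * _ = _ at h1
  simp only [Fin.prod_univ_two, Fin.val_zero, Fin.val_one, pow_zero, pow_one] at h1
  obtain ⟨q, hq⟩ : ∃ q, Fintype.card F = q + 1 := ⟨Fintype.card F - 1, by omega⟩
  rw [hq] at h1 h2 h3 ⊢
  have e1 : (q + 1) ^ 2 - 1 = q * (q + 2) := by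
    rw [show (q + 1) ^ 2 = q * (q + 2) + 1 by ring]; rfl
  have e2 : (q + 1) ^ 2 - (q + 1) = q * (q + 1) := by
    rw [show (q + 1) ^ 2 = q * (q + 1) + (q + 1) by ring, Nat.add_sub_cancel]
  rw [e1, e2] at h1
  have h4 := Nat.mul_le_mul_left (Nat.card (moebiusGroup F)) h2
  rw [h1] at h4
  simp only [Nat.add_sub_cancel] at h4 ⊢
  refine Nat.le_of_mul_le_mul_right (c := q) ?_ (by omega)
  calc _ = q * (q + 2) * (q * (q + 1)) := by ring
    _ ≤ _ := h4

end Moebius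

theorem corollary5p5 (q : ℕ) (hq : IsPrimePow q) (hq5 : 5 < q) (hmod3 : q ≡ 2 [MOD 3])
    (hmod5_zero : ¬ q ≡ 0 [MOD 5]) (hmod5_one : ¬ q ≡ 1 [MOD 5]) :
    q * (q - 1) * (q + 1) ≤ maxPermArray (q - 1) (q - 5) ∧
      q * (q + 1) ≤ maxPermArray (q - 2) (q - 5) := by
  classical
  have hfirst : q * (q - 1) * (q + 1) ≤ maxPermArray (q - 1) (q - 5) := by
    obtain ⟨p, k, hp, hk, rfl⟩ := (isPrimePow_nat_iff q).1 hq
    have : Fact p.Prime := ⟨hp⟩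
    set q := p ^ k with hqdef
    let F := GaloisField p k
    have : Fintype F := Fintype.ofFinite F
    have hF : Fintype.card F = q := by
      rw [← Nat.card_eq_fintype_card]; exact GaloisField.card p k hk.ne'
    have c30 : Nat.Coprime 3 q := by
      rw [Nat.Prime.coprime_iff_not_dvd Nat.prime_three]; unfold Nat.ModEq at *; omega
    have c31 : Nat.Coprime 3 (q - 1) := by
      rw [Nat.Prime.coprime_iff_not_dvd Nat.prime_three]; unfold Nat.ModEq at *; omega
    have c50 : Nat.Coprime 5 q := by
      rw [Nat.Prime.coprime_iff_not_dvd Nat.prime_five]; unfold Nat.ModEq at *; omega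
    have c51 : Nat.Coprime 5 (q - 1) := by
      rw [Nat.Prime.coprime_iff_not_dvd Nat.prime_five]; unfold Nat.ModEq at *; omega
    have hcard := le_card_moebiusGroup (F := F)
    rw [hF, Nat.card_eq_fintype_card] at hcard
    refine hcard.trans ?_
    let o : OnePoint F := ((0 : F) : OnePoint F)
    have ho : (OnePoint.infty : OnePoint F) ≠ o := OnePoint.infty_ne_coe 0
    have hc1 : Fintype.card (OnePoint F) = q + 1 := by
      rw [← hF]; exact Fintype.card_option
    have := card_le_maxPermArray_of_fixed (ι := moebiusGroup F) {OnePoint.infty, o}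
      (d := q - 5) (by omega) (fun σ => contract o (contract OnePoint.infty σ.1)) ?_ ?_
    · rwa [hc1, Finset.card_pair ho] at this
    · intro σ x hx
      rcases Finset.mem_insert.1 hx with rfl | hx
      · exact contract_apply_of_fixed (contract_apply_self _ _)
      · rw [Finset.mem_singleton.1 hx]
        exact contract_apply_self _ _
    · intro σ τ hne
      rw [hammingDist_perm_eq_card_support, contract_inv_mul_contract, contract_inv_mul_contract]
      have hmem : τ.1⁻¹ * σ.1 ∈ moebiusGroup F := mul_mem (inv_mem τ.2) σ.2
      have hne1 : τ.1⁻¹ * σ.1 ≠ 1 := fun e => hne (Subtype.ext (inv_mul_eq_one.1 e).symm)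
      generalize σ.1⁻¹ OnePoint.infty = a
      generalize (contract OnePoint.infty σ.1)⁻¹ o = b
      generalize τ.1⁻¹ * σ.1 = π at hmem hne1
      by_cases hx : ∃ x, π x = x
      · obtain ⟨x, hx⟩ := hx
        have h2 := card_le_card_support_add_two hmem hne1
        have h4 := card_support_le_contractQuot_contractQuot (n := OnePoint.infty) (a := a) o b
          (noCycle_of_mem_moebiusGroup (k := 3) (by rwa [hF]) (by rwa [hF]) hmem hx)
          (noCycle_of_mem_moebiusGroup (k := 5) (by rwa [hF]) (by rwa [hF]) hmem hx)
        rw [hF] at h2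
        omega
      -- a fixed-point-free quotient can lose three moved points in either contraction
      · have hs : π.support = Finset.univ := by
          ext x
          simpa using fun e => hx ⟨x, e⟩
        have h3 := card_support_le_contractQuot_add_three OnePoint.infty a π
        have h3' := card_support_le_contractQuot_add_three o b
          (contractQuot OnePoint.infty a π)
        rw [hs, Finset.card_univ, hc1] at h3
        omega
  -- restrict to the permutations sharing the most frequent value at one symbol
  refine ⟨hfirst, le_maxPermArray_of_mul_le (by omega) ?_⟩
  rw [show q - 2 + 1 = q - 1 by omega]
  exact le_of_eq_of_le (by ring) hfirst
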